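/- Let $G$ be a finite group. For $k\ge 0$ let $E_kG=G^{*(k+1)}$ be the $(k+1)$-fold join of the discrete space $G$ with itself, on which $G$ acts by left translation on each factor. For a topological space $X$ with an action of $G$, let $\operatorname{ind} X$ be the least $k\ge 0$ such that there is a continuous $G$-equivariant map $X\to E_kG$ (and $\infty$ if there is none). A finite $G$-simplicial complex is a finite simplicial complex on which $G$ acts by simplicial automorphisms; it is free if $G$ acts freely on its geometric realization, and its index is that of its geometric realization. Products of $G$-spaces carry the diagonal action. Suppose that $G$ is neither a cyclic $p$-group for a prime $p$ (the trivial group counts as one) nor isomorphic to a generalized quaternion group $\langle a,b : a^n=b^2,\ a^{2n}=1,\ b^{-1}ab=a^{-1}\rangle$, $n\ge 2$, whose order is a power of $2$. Then there exist finite free $G$-simplicial complexes $\mathcal K_1$ and $\mathcal K_2$ such that \[ \operatorname{ind}\mathcal K_1=\operatorname{ind}\mathcal K_2=1\quad\text{but}\quad \operatorname{ind}(\mathcal K_1\times\mathcal K_2)=0 . \] In particular, $\operatorname{ind}(\mathcal K_1\times\mathcal K_2)\ne\min\{\operatorname{ind}\mathcal K_1,\operatorname{ind}\mathcal K_2\}$.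 -/

import Mathlib

universe u v

/-- A group is *nice* if it is a cyclic `p`-group for some prime `p`, or a generalized quaternion
group `⟨a, b : a ^ n = b ^ 2, a ^ (2 * n) = 1, b⁻¹ * a * b = a⁻¹⟩`, `n ≥ 2`, whose order is a
power of `2`. -/
def IsNiceGroup (G : Type u) [Group G] : Prop :=
  (∃ p : ℕ, p.Prime ∧ IsPGroup p G ∧ IsCyclic G) ∨
    (∃ n : ℕ, 2 ≤ n ∧ Nonempty (G ≃* QuaternionGroup n) ∧ ∃ k : ℕ, Nat.card G = 2 ^ k)

/-- A finite `G`-simplicial complex: a finite abstract simplicial complex on which `G` acts by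
simplicial automorphisms. -/
structure FiniteGComplex (G : Type u) [Group G] where
  /-- the vertices -/
  V : Type v
  /-- the vertex set is finite -/
  finite : Finite V
  /-- the action of `G` on the vertices -/
  action : MulAction G V
  /-- the simplices; every vertex is one -/
  complex : AbstractSimplicialComplex V
  /-- the action maps simplices to simplices -/
  smul_mem : ∀ (g : G) (s : Finset V), s ∈ complex.faces →
    s.map (MulAction.toPerm g).toEmbedding ∈ complex.faces

namespace FiniteGComplex

variable {G : Type u} [Group G]

instance (K : FiniteGComplex.{u, v} G) : MulAction G K.V := K.action

/-- The points of the geometric realization in barycentric coordinates: the convex weights on the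
vertices whose support is a simplex. -/
def points (K : FiniteGComplex.{u, v} G) : Set (K.V → ℝ) :=
  {x | (∀ a, 0 ≤ x a) ∧ ∃ s ∈ K.complex.faces, Function.support x = (s : Set K.V) ∧
    ∑ a ∈ s, x a = 1}

/-- The geometric realization `|K|`, with the topology induced from the finite-dimensional space
of real functions on the vertices. -/
abbrev Realization (K : FiniteGComplex.{u, v} G) : Type v := K.points

theorem smul_mem_points (K : FiniteGComplex.{u, v} G) (g : G) {x : K.V → ℝ} (hx : x ∈ K.points) :
    (fun a => x (g⁻¹ • a)) ∈ K.points := by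
  obtain ⟨h0, s, hs, hsupp, hsum⟩ := hx
  refine ⟨fun a => h0 _, _, K.smul_mem g s hs, ?_, ?_⟩
  · ext a
    have h : x (g⁻¹ • a) ≠ 0 ↔ g⁻¹ • a ∈ s := by
      rw [← Function.mem_support, hsupp, Finset.mem_coe]
    simp only [Function.mem_support, h, Finset.coe_map, Set.mem_image, Finset.mem_coe]
    constructor
    · intro ha
      exact ⟨_, ha, by simp⟩
    · rintro ⟨b, hb, rfl⟩
      simpa using hb
  · simpa using hsum

/-- The action of `G` on `|K|`: the affine extension of the action on the vertices. -/
instance (K : FiniteGComplex.{u, v} G) : MulAction G K.Realization where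
  smul g x := ⟨fun a => x.1 (g⁻¹ • a), K.smul_mem_points g x.2⟩
  one_smul x := Subtype.ext (funext fun a => congrArg x.1 (by simp))
  mul_smul g h x := Subtype.ext (funext fun a => congrArg x.1 (by simp [mul_smul]))

/-- `K` is free if `G` acts freely on the realization `|K|`. -/
def IsFree (K : FiniteGComplex.{u, v} G) : Prop :=
  ∀ (g : G) (x : K.Realization), g • x = x → g = 1

end FiniteGComplex

/-- The `n`-fold simplicial join of a complex with itself: the vertices are `n` disjoint copies of
those of `K`, and a nonempty finite set is a simplex if its part in each copy is empty or a simplex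
of `K`. -/
def joinPower {V : Type u} (K : AbstractSimplicialComplex V) (n : ℕ) :
    AbstractSimplicialComplex (V × Fin n) where
  faces := {s | s.Nonempty ∧ ∀ i : Fin n,
    s.preimage (fun a => (a, i)) (Prod.mk_left_injective i).injOn = ∅ ∨
      s.preimage (fun a => (a, i)) (Prod.mk_left_injective i).injOn ∈ K.faces}
  isRelLowerSet_faces := by
    rintro s ⟨hs, h⟩
    refine ⟨hs, fun t hts ht => ⟨ht, fun i => ?_⟩⟩
    rcases Finset.eq_empty_or_nonempty
      (t.preimage (fun a => (a, i)) (Prod.mk_left_injective i).injOn) with h0 | h0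
    · exact Or.inl h0
    · refine Or.inr ?_
      have hsub : t.preimage (fun a => (a, i)) (Prod.mk_left_injective i).injOn ⊆
          s.preimage (fun a => (a, i)) (Prod.mk_left_injective i).injOn := by
        intro a ha
        rw [Finset.mem_preimage] at ha ⊢
        exact hts ha
      rcases h i with h1 | h1
      · rw [h1, Finset.subset_empty] at hsub
        exact absurd hsub h0.ne_empty
      · exact (K.isRelLowerSet_faces h1).2 hsub h0
  singleton_mem := by
    rintro ⟨b, j⟩
    refine ⟨Finset.singleton_nonempty _, fun i => ?_⟩
    by_cases hij : j = i
    · subst hij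
      refine Or.inr ?_
      convert K.singleton_mem b
      ext a
      simp
    · refine Or.inl ?_
      ext a
      simp [Ne.symm hij]

/-- The discrete (zero-dimensional) complex on a vertex set: the simplices are the vertices. -/
def discreteComplex (V : Type u) : AbstractSimplicialComplex V where
  faces := {s | ∃ a, s = {a}}
  isRelLowerSet_faces := by
    rintro s ⟨a, rfl⟩
    refine ⟨Finset.singleton_nonempty a, fun t hts ht => ⟨a, ?_⟩⟩
    exact (Finset.subset_singleton_iff.mp hts).resolve_left ht.ne_empty
  singleton_mem a := ⟨a, rfl⟩

/-- The action of `G` on `n` copies of `G` by left translation on every copy: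
`g • (h, i) = (g * h, i)`. -/
abbrev layerAction (G : Type u) [Group G] (n : ℕ) : MulAction G (G × Fin n) where
  smul g a := (g * a.1, a.2)
  one_smul a := Prod.ext (one_mul a.1) rfl
  mul_smul g h a := Prod.ext (mul_assoc g h a.1) rfl

/-- The complex `E_k G`, the `(k + 1)`-fold join of the discrete space `G` with itself,
on which `G` acts by left translation. -/
def EComplex (G : Type u) [Group G] [Finite G] (k : ℕ) : FiniteGComplex.{u, u} G where
  V := G × Fin (k + 1)
  finite := inferInstance
  action := layerAction G (k + 1)
  complex := joinPower (discreteComplex G) (k + 1)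
  smul_mem := by
    rintro g s ⟨hs, h⟩
    refine ⟨hs.map, fun i => ?_⟩
    have key : ∀ b : G, b ∈ (s.map (@MulAction.toPerm G (G × Fin (k + 1)) _
        (layerAction G (k + 1)) g).toEmbedding).preimage (fun a => (a, i)) (Prod.mk_left_injective i).injOn ↔ (g⁻¹ * b, i) ∈ s := by
      intro b
      rw [Finset.mem_preimage, Finset.mem_map]
      constructor
      · rintro ⟨⟨c, j⟩, hc, hcb⟩
        have h1 : g * c = b := congrArg Prod.fst hcb
        have h2 : j = i := congrArg Prod.snd hcb
        rw [← h1, ← h2]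
        simpa using hc
      · intro hb
        exact ⟨_, hb, Prod.ext (mul_inv_cancel_left g b) rfl⟩
    rcases h i with h1 | ⟨c, h1⟩
    · refine Or.inl (Finset.eq_empty_of_forall_notMem fun b hb => ?_)
      have h2 := Finset.ext_iff.mp h1 (g⁻¹ * b)
      rw [Finset.mem_preimage] at h2
      exact Finset.notMem_empty _ (h2.mp ((key b).mp hb))
    · refine Or.inr ⟨g * c, Finset.ext fun b => ?_⟩
      have h2 := Finset.ext_iff.mp h1 (g⁻¹ * b)
      rw [Finset.mem_preimage, Finset.mem_singleton] at h2
      rw [key b, h2, Finset.mem_singleton, inv_mul_eq_iff_eq_mul]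

/-- The mapping index of a `G`-space `X`: the least `k` for which there is a continuous
`G`-equivariant map from `X` to `E_k G` (and `⊤` if there is none). -/
noncomputable def mappingIndex (G : Type u) [Group G] [Finite G] (X : Type v) [TopologicalSpace X]
    [MulAction G X] : ℕ∞ :=
  ⨅ (k : ℕ) (_ : ∃ f : X → (EComplex G k).Realization,
    Continuous f ∧ ∀ (g : G) (x : X), f (g • x) = g • f x), (k : ℕ∞)

/-!
Let `H₁`, `H₂` be nontrivial subgroups of `G` such that every conjugate of `H₁` meets `H₂`
trivially, and let `K_i` be the subgraph of `E_1 G` whose simplices lie in one left coset of `H_i`.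
The coset gives a locally constant equivariant map `|K_i| → G ⧸ H_i`, and `G` acts freely on
`(G ⧸ H₁) × (G ⧸ H₂)`, so `|K₁| × |K₂|` has a locally constant equivariant map to `G`, which is to
say index `0`. On the other hand `K_i` contains a path from a vertex to its translate by some
`h ≠ 1`, which no locally constant equivariant map to `G` allows, and `K_i ⊆ E_1 G`; so its index
is `1`.

If two primes divide `|G|`, subgroups of these orders serve as `H₁` and `H₂`. In a `p`-group, take
a central subgroup of order `p` and any other subgroup of order `p`. The latter exists unless `G` is
cyclic or generalized quaternion: if the subgroup of order `p` is unique, a maximal abelian normal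
subgroup is cyclic, say generated by `a`, and is its own centralizer. For `b` outside it with
`b ^ p = a ^ j` and `b * a * b⁻¹ = a ^ r`, one has
`(a ^ s * b) ^ p = a ^ (s * (1 + r + ⋯ + r ^ (p - 1)) + j)`, and some `s` makes this trivial, giving
an element of order `p` outside `⟨a⟩`, unless `p = 2`, `b` inverts `a` and `b ^ 2` is the involution
of `⟨a⟩`.
-/

section Realization

namespace FiniteGComplex

variable {G : Type u} [Group G] {K : FiniteGComplex.{u, v} G}

theorem exists_face_iff (x : K.Realization) : ∃ s ∈ K.complex.faces, ∀ a, x.1 a ≠ 0 ↔ a ∈ s := by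
  obtain ⟨-, s, hs, hsupp, -⟩ := x.2
  exact ⟨s, hs, fun a => by rw [← Function.mem_support, hsupp, Finset.mem_coe]⟩

theorem exists_ne_zero (x : K.Realization) : ∃ a, x.1 a ≠ 0 := by
  obtain ⟨s, hs, h⟩ := exists_face_iff x
  obtain ⟨a, ha⟩ := (K.complex.isRelLowerSet_faces hs).1
  exact ⟨a, (h a).mpr ha⟩

theorem smul_apply_smul (g : G) (x : K.Realization) (a : K.V) : (g • x).1 (g • a) = x.1 a :=
  congrArg x.1 (inv_smul_smul g a)

theorem mem_points_of_face {x : K.V → ℝ} (h0 : ∀ a, 0 ≤ x a) {s : Finset K.V}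
    (hs : s ∈ K.complex.faces) (hx : ∀ a, x a ≠ 0 → a ∈ s) (hsum : ∑ a ∈ s, x a = 1) :
    x ∈ K.points := by
  have hsum' : ∑ a ∈ s with x a ≠ 0, x a = 1 := by rw [Finset.sum_filter_ne_zero, hsum]
  have hne : (s.filter fun a => x a ≠ 0).Nonempty :=
    Finset.nonempty_of_sum_ne_zero (hsum'.trans_ne one_ne_zero)
  refine ⟨h0, _, (K.complex.isRelLowerSet_faces hs).2 (Finset.filter_subset _ _) hne, ?_, hsum'⟩
  ext a
  simpa using hx a

variable [DecidableEq K.V]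

variable (K) in
/-- The point of `|K|` at a vertex. -/
def vertexPoint (a : K.V) : K.Realization :=
  ⟨Pi.single a 1, mem_points_of_face
    (fun b => (Pi.single_nonneg.mpr zero_le_one : (0 : K.V → ℝ) ≤ Pi.single a 1) b)
    (K.complex.singleton_mem a)
    (fun b hb => Finset.mem_singleton.mpr (by contrapose! hb; exact Pi.single_eq_of_ne hb _))
    (by simp)⟩

theorem vertexPoint_smul (g : G) (a : K.V) : K.vertexPoint (g • a) = g • K.vertexPoint a := by
  refine Subtype.ext (funext fun b => ?_)
  change (Pi.single (g • a) 1 : K.V → ℝ) b = (Pi.single a 1 : K.V → ℝ) (g⁻¹ • b)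
  simp only [Pi.single_apply, inv_smul_eq_iff]

theorem segment_single_subset_points {s : Finset K.V} (hs : s ∈ K.complex.faces) {a b : K.V}
    (ha : a ∈ s) (hb : b ∈ s) : segment ℝ (Pi.single a 1) (Pi.single b 1) ⊆ K.points := by
  rintro _ ⟨t, u, ht, hu, htu, rfl⟩
  refine mem_points_of_face (fun c => ?_) hs (fun c hc => ?_) ?_
  · simp only [Pi.add_apply, Pi.smul_apply, Pi.single_apply, smul_eq_mul]
    positivity
  · by_contra hcs
    exact hc (by simp [Pi.single_eq_of_ne, ne_of_mem_of_not_mem ha hcs |>.symm,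
      ne_of_mem_of_not_mem hb hcs |>.symm])
  · simpa [Finset.sum_add_distrib, ← Finset.mul_sum, ha, hb] using htu

theorem joined_vertexPoint {s : Finset K.V} (hs : s ∈ K.complex.faces) {a b : K.V} (ha : a ∈ s)
    (hb : b ∈ s) : Joined (K.vertexPoint a) (K.vertexPoint b) :=
  (JoinedIn.of_segment_subset (segment_single_subset_points hs ha hb)).joined_subtype

end FiniteGComplex

end Realization

section Monochromatic

namespace FiniteGComplex

variable {G : Type u} [Group G] {K : FiniteGComplex.{u, v} G} {Q : Type*} [SMul G Q]

/-- The equivariant vertex colouring `q` takes a single value on every simplex. -/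
def IsConstantOnFaces (q : K.V →[G] Q) : Prop :=
  ∀ s ∈ K.complex.faces, ∀ a ∈ s, ∀ b ∈ s, q a = q b

namespace IsConstantOnFaces

variable {q : K.V →[G] Q}

theorem apply_eq (hq : IsConstantOnFaces q) {x : K.Realization} {a b : K.V} (ha : x.1 a ≠ 0)
    (hb : x.1 b ≠ 0) : q a = q b := by
  obtain ⟨s, hs, h⟩ := exists_face_iff x
  exact hq s hs _ ((h a).mp ha) _ ((h b).mp hb)

/-- The extension to `|K|` of a vertex colouring that is constant on simplices. -/
noncomputable def extend (hq : IsConstantOnFaces q) : K.Realization →[G] Q where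
  toFun x := q (exists_ne_zero x).choose
  map_smul' g x := by
    have h : (g • x).1 (g • (exists_ne_zero x).choose) ≠ 0 := by
      rw [smul_apply_smul]
      exact (exists_ne_zero x).choose_spec
    rw [hq.apply_eq (exists_ne_zero (g • x)).choose_spec h, map_smul, id]

theorem extend_eq (hq : IsConstantOnFaces q) {x : K.Realization} {a : K.V} (ha : x.1 a ≠ 0) :
    hq.extend x = q a :=
  hq.apply_eq (exists_ne_zero x).choose_spec ha

theorem isLocallyConstant_extend (hq : IsConstantOnFaces q) : IsLocallyConstant hq.extend := by
  rw [IsLocallyConstant.iff_exists_open]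
  intro x
  obtain ⟨a, ha⟩ := exists_ne_zero x
  refine ⟨{y | y.1 a ≠ 0}, ?_, ha, fun y hy => (hq.extend_eq hy).trans (hq.extend_eq ha).symm⟩
  exact isOpen_ne_fun ((continuous_apply a).comp continuous_subtype_val) continuous_const

end IsConstantOnFaces

/-- The subcomplex of the simplices on which the equivariant vertex colouring `q` is constant. -/
abbrev monochromatic (K : FiniteGComplex.{u, v} G) (q : K.V →[G] Q) : FiniteGComplex.{u, v} G where
  V := K.V
  finite := K.finite
  action := K.action
  complex :=
    { faces := {s | s ∈ K.complex.faces ∧ ∀ a ∈ s, ∀ b ∈ s, q a = q b}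
      isRelLowerSet_faces := fun s hs => ⟨(K.complex.isRelLowerSet_faces hs.1).1, fun _ hts ht =>
        ⟨(K.complex.isRelLowerSet_faces hs.1).2 hts ht,
          fun a ha b hb => hs.2 a (hts ha) b (hts hb)⟩⟩
      singleton_mem := fun a => ⟨K.complex.singleton_mem a, by simp⟩ }
  smul_mem := fun g s hs => ⟨K.smul_mem g s hs.1, by
    simp only [Finset.forall_mem_map, Equiv.coe_toEmbedding, MulAction.toPerm_apply, map_smul]
    exact fun a ha b hb => congrArg (g • ·) (hs.2 a ha b hb)⟩

theorem isConstantOnFaces_monochromatic (q : K.V →[G] Q) :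
    IsConstantOnFaces (K := K.monochromatic q) q :=
  fun _ hs => hs.2

theorem joined_vertexPoint_monochromatic [DecidableEq K.V] {q : K.V →[G] Q} {a b : K.V}
    (hab : {a, b} ∈ K.complex.faces) (hq : q a = q b) :
    Joined ((K.monochromatic q).vertexPoint a) ((K.monochromatic q).vertexPoint b) :=
  joined_vertexPoint (K := K.monochromatic q) (s := {a, b}) ⟨hab, by simp [hq]⟩ (by simp) (by simp)

/-- The inclusion of the realization of the monochromatic subcomplex. -/
def monochromaticInclusion (q : K.V →[G] Q) :
    (K.monochromatic q).Realization →[G] K.Realization where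
  toFun x := ⟨x.1, x.2.1, x.2.2.imp fun _ hs => ⟨hs.1.1, hs.2⟩⟩
  map_smul' _ _ := rfl

theorem continuous_monochromaticInclusion (q : K.V →[G] Q) :
    Continuous (monochromaticInclusion q) :=
  continuous_subtype_val.subtype_mk _

theorem IsFree.monochromatic (hK : K.IsFree) (q : K.V →[G] Q) : (K.monochromatic q).IsFree :=
  fun g x hgx => hK g (monochromaticInclusion q x) <| by
    rw [← map_smul, hgx]

end FiniteGComplex

end Monochromatic

section EComplex

namespace EComplex

variable {G : Type u} [Group G] [Finite G]

/-- The index of the copy of `G` in which a vertex of `E_k G` lies. -/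
def layer {k : ℕ} (a : (EComplex G k).V) : Fin (k + 1) := Prod.snd a

theorem mem_faces {k : ℕ} {s : Finset (EComplex G k).V} :
    s ∈ (EComplex G k).complex.faces ↔
      s.Nonempty ∧ Set.InjOn layer (s : Set (EComplex G k).V) := by
  refine and_congr_right fun _ => ⟨fun h => ?_, fun h i => ?_⟩
  · rintro ⟨a, i⟩ ha ⟨b, j⟩ hb (rfl : i = j)
    have hab (c : G) (hc : (c, i) ∈ (s : Set (EComplex G k).V)) :
        c ∈ s.preimage (fun a => (a, i)) (Prod.mk_left_injective i).injOn :=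
      Finset.mem_preimage.mpr hc
    rcases h i with h | ⟨c, h⟩
    · exact absurd (h ▸ hab a ha) (Finset.notMem_empty a)
    · obtain rfl : a = c := Finset.mem_singleton.mp (h ▸ hab a ha)
      obtain rfl : b = a := Finset.mem_singleton.mp (h ▸ hab b hb)
      rfl
  · rcases Finset.eq_empty_or_nonempty
      (s.preimage (fun a => (a, i)) (Prod.mk_left_injective i).injOn) with h0 | ⟨c, hc⟩
    · exact Or.inl h0
    · refine Or.inr ⟨c, Finset.eq_singleton_iff_unique_mem.mpr ⟨hc, fun b hb => ?_⟩⟩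
      exact congrArg Prod.fst
        (h (Finset.mem_preimage.mp hb) (Finset.mem_preimage.mp hc) rfl)

/-- The element `a` in the `i`-th copy of `G`, as a vertex of `E_k G`. -/
def vertex {k : ℕ} (i : Fin (k + 1)) : G →[G] (EComplex G k).V where
  toFun a := (a, i)
  map_smul' _ _ := rfl

theorem pair_mem_faces {k : ℕ} [DecidableEq (EComplex G k).V] {i j : Fin (k + 1)} (hij : i ≠ j)
    (a b : G) :
    {vertex i a, vertex j b} ∈ (EComplex G k).complex.faces := by
  refine mem_faces.mpr ⟨Finset.insert_nonempty _ _, ?_⟩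
  rw [Finset.coe_pair]
  exact Set.injOn_pair.mpr fun h => absurd h hij

variable (G) in
/-- The vertices of `E_k G` are coloured equivariantly by forgetting the copy of `G`. -/
def fst (k : ℕ) : (EComplex G k).V →[G] G where
  toFun := Prod.fst
  map_smul' _ _ := rfl

theorem isFree (k : ℕ) : (EComplex G k).IsFree := by
  intro g x hgx
  obtain ⟨a, ha⟩ := FiniteGComplex.exists_ne_zero x
  obtain ⟨s, hs, h⟩ := FiniteGComplex.exists_face_iff x
  have hga : x.1 (g • a) ≠ 0 := by
    rwa [← congrArg Subtype.val hgx, FiniteGComplex.smul_apply_smul]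
  have : g • a = a := (mem_faces.mp hs).2 ((h _).mp hga) ((h _).mp ha) rfl
  exact mul_eq_right.mp (congrArg Prod.fst this)

theorem isConstantOnFaces_fst_zero : FiniteGComplex.IsConstantOnFaces (fst G 0) :=
  fun _ hs _ ha _ hb => congrArg Prod.fst
    ((mem_faces.mp hs).2 ha hb (Subsingleton.elim (α := Fin 1) _ _))

end EComplex

end EComplex

section MappingIndex

variable {G : Type u} [Group G] [Finite G] {X : Type v} [TopologicalSpace X] [MulAction G X]

theorem mappingIndex_le {k : ℕ} (f : X →[G] (EComplex G k).Realization) (hf : Continuous f) :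
    mappingIndex G X ≤ k :=
  iInf₂_le k ⟨f, hf, map_smul f⟩

theorem mappingIndex_eq_zero_iff :
    mappingIndex G X = 0 ↔ ∃ f : X →[G] G, IsLocallyConstant f := by
  classical
  constructor
  · intro h
    obtain ⟨f, hf, hfG⟩ : ∃ f : X → (EComplex G 0).Realization,
        Continuous f ∧ ∀ (g : G) (x : X), f (g • x) = g • f x := by
      by_contra hcon
      refine one_ne_zero (le_zero_iff.mp ((le_iInf₂ fun k hk => ?_).trans_eq h))
      exact_mod_cast Nat.one_le_iff_ne_zero.mpr fun h0 => hcon (h0 ▸ hk)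
    have hfst := EComplex.isConstantOnFaces_fst_zero (G := G)
    exact ⟨hfst.extend.comp ⟨f, hfG⟩, hfst.isLocallyConstant_extend.comp_continuous hf⟩
  · rintro ⟨f, hf⟩
    let e : G →[G] (EComplex G 0).Realization :=
      ⟨fun a => (EComplex G 0).vertexPoint (EComplex.vertex 0 a), fun g a => by
        rw [map_smul, FiniteGComplex.vertexPoint_smul]; rfl⟩
    exact le_zero_iff.mp (mappingIndex_le (e.comp f) (hf.comp e).continuous)

theorem nonempty_mulActionHom_of_isCancelSMul (G Y : Type*) [Group G] [MulAction G Y]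
    [IsCancelSMul G Y] : Nonempty (Y →[G] G) := by
  let r : Y → Y := fun y => (Quotient.mk (MulAction.orbitRel G Y) y).out
  have hr (g : G) (y : Y) : r (g • y) = r y :=
    congrArg Quotient.out (Quotient.sound (MulAction.orbitRel_apply.mpr ⟨g, rfl⟩))
  have hrep (y : Y) : ∃ g : G, g • r y = y :=
    MulAction.orbitRel_apply.mp ((MulAction.orbitRel G Y).symm (Quotient.mk_out y))
  choose f hf using hrep
  refine ⟨⟨f, fun g y => IsCancelSMul.right_cancel _ _ (r y) ?_⟩⟩
  calc f (g • y) • r y = g • y := by rw [← hr g y, hf]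
    _ = (g • f y) • r y := by rw [smul_assoc, hf]

theorem mappingIndex_eq_zero_of_isLocallyConstant {Y : Type*} [MulAction G Y] [IsCancelSMul G Y]
    (f : X →[G] Y) (hf : IsLocallyConstant f) : mappingIndex G X = 0 :=
  let ⟨e⟩ := nonempty_mulActionHom_of_isCancelSMul G Y
  mappingIndex_eq_zero_iff.mpr ⟨e.comp f, hf.comp e⟩

theorem mappingIndex_ne_zero_of_joined_smul {g : G} (hg : g ≠ 1) {x : X} (hx : Joined x (g • x)) :
    mappingIndex G X ≠ 0 := by
  rw [Ne, mappingIndex_eq_zero_iff]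
  rintro ⟨f, hf⟩
  have h : f x = f (g • x) :=
    hf.apply_eq_of_isPreconnected isPreconnected_connectedComponent mem_connectedComponent
      (pathComponent_subset_component x hx)
  rw [map_smul, smul_eq_mul, eq_comm, mul_eq_right] at h
  exact hg h

end MappingIndex

section CosetGraph

open Pointwise

variable {G : Type u} [Group G]

theorem isCancelSMul_quotient_prod_quotient {H₁ H₂ : Subgroup G}
    (h : ∀ g : G, Disjoint (MulAut.conj g • H₁) H₂) : IsCancelSMul G ((G ⧸ H₁) × (G ⧸ H₂)) := by
  rw [isCancelSMul_iff_eq_one_of_smul_eq]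
  rintro g ⟨⟨a⟩, ⟨b⟩⟩ hg
  have ha : ((g * a : G) : G ⧸ H₁) = a := congrArg Prod.fst hg
  have hb : ((g * b : G) : G ⧸ H₂) = b := congrArg Prod.snd hg
  rw [eq_comm, QuotientGroup.eq] at ha hb
  have h₁ : b⁻¹ * (g * b) ∈ MulAut.conj (b⁻¹ * a) • H₁ := by
    rw [Subgroup.mem_pointwise_smul_iff_inv_smul_mem, ← map_inv, MulAut.smul_def,
      MulAut.conj_apply]
    simpa [mul_assoc] using ha
  have hone : b⁻¹ * (g * b) = 1 := Subgroup.disjoint_def.mp (h _) h₁ hb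
  exact mul_eq_right.mp (inv_mul_eq_one.mp hone).symm

variable [Finite G]

/-- The subgraph `G ×_H E_1 H` of `E_1 G`, whose simplices lie in a single left coset of `H`. -/
abbrev cosetGraph (H : Subgroup G) : FiniteGComplex.{u, u} G :=
  (EComplex G 1).monochromatic ((MulActionHom.toQuotient H).comp (EComplex.fst G 1))

theorem cosetGraph_isFree (H : Subgroup G) : (cosetGraph H).IsFree :=
  (EComplex.isFree 1).monochromatic _

theorem mappingIndex_cosetGraph_prod_cosetGraph {H₁ H₂ : Subgroup G}
    (h : ∀ g : G, Disjoint (MulAut.conj g • H₁) H₂) :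
    mappingIndex G ((cosetGraph H₁).Realization × (cosetGraph H₂).Realization) = 0 := by
  have := isCancelSMul_quotient_prod_quotient h
  have hq (H : Subgroup G) := FiniteGComplex.isConstantOnFaces_monochromatic
    ((MulActionHom.toQuotient H).comp (EComplex.fst G 1))
  exact mappingIndex_eq_zero_of_isLocallyConstant
    (((hq H₁).extend.comp (.fst G _ _)).prod ((hq H₂).extend.comp (.snd G _ _)))
    (((hq H₁).isLocallyConstant_extend.comp_continuous continuous_fst).prodMk
      ((hq H₂).isLocallyConstant_extend.comp_continuous continuous_snd))

theorem joined_smul_cosetGraph [DecidableEq (EComplex G 1).V] {H : Subgroup G} {h : G}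
    (hh : h ∈ H) :
    Joined ((cosetGraph H).vertexPoint (EComplex.vertex 0 1))
      (h • (cosetGraph H).vertexPoint (EComplex.vertex 0 1)) := by
  have hedge {a b : G} (hab : a⁻¹ * b ∈ H) :
      Joined ((cosetGraph H).vertexPoint (EComplex.vertex 0 a))
        ((cosetGraph H).vertexPoint (EComplex.vertex 1 b)) :=
    FiniteGComplex.joined_vertexPoint_monochromatic (EComplex.pair_mem_faces zero_ne_one a b)
      (QuotientGroup.eq.mpr hab)
  rw [← FiniteGComplex.vertexPoint_smul, ← map_smul, smul_eq_mul, mul_one]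
  exact (hedge (by simpa using hh)).trans (hedge (by simp)).symm

theorem mappingIndex_cosetGraph {H : Subgroup G} (hH : H ≠ ⊥) :
    mappingIndex G (cosetGraph H).Realization = 1 := by
  classical
  obtain ⟨h, hh, hne⟩ := (Subgroup.bot_or_exists_ne_one H).resolve_left hH
  refine le_antisymm ?_ (Order.one_le_iff_ne_zero.mpr
    (mappingIndex_ne_zero_of_joined_smul hne (joined_smul_cosetGraph hh)))
  exact mappingIndex_le (k := 1) (FiniteGComplex.monochromaticInclusion _)
    (FiniteGComplex.continuous_monochromaticInclusion _)

end CosetGraph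

section Nilpotent

variable {G : Type*} [Group G]

theorem inf_center_ne_bot [Group.IsNilpotent G] {N : Subgroup G} [N.Normal] (hN : N ≠ ⊥) :
    N ⊓ Subgroup.center G ≠ ⊥ := by
  classical
  have hex : ∃ k, N ⊓ Subgroup.upperCentralSeries G k ≠ ⊥ := by
    obtain ⟨c, hc⟩ := Group.IsNilpotent.nilpotent G
    exact ⟨c, by rwa [hc, inf_top_eq]⟩
  obtain ⟨k, hk⟩ : ∃ k, Nat.find hex = k + 1 := Nat.exists_eq_succ_of_ne_zero fun h0 =>
    Nat.find_spec hex (by rw [h0, Subgroup.upperCentralSeries_zero, inf_bot_eq])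
  have hbot : N ⊓ Subgroup.upperCentralSeries G k = ⊥ :=
    not_not.mp (Nat.find_min hex (hk ▸ k.lt_succ_self))
  have hle : N ⊓ Subgroup.upperCentralSeries G (k + 1) ≤ N ⊓ Subgroup.center G := by
    rintro x ⟨hxN, hx⟩
    refine ⟨hxN, Subgroup.mem_center_iff.mpr fun g => ?_⟩
    have hcomm : x * g * x⁻¹ * g⁻¹ ∈ N ⊓ Subgroup.upperCentralSeries G k := by
      refine ⟨?_, Subgroup.mem_upperCentralSeries_succ_iff.mp hx g⟩
      rw [mul_assoc x, mul_assoc x]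
      exact N.mul_mem hxN (Subgroup.Normal.conj_mem ‹_› _ (N.inv_mem hxN) g)
    rw [hbot, Subgroup.mem_bot, mul_inv_eq_one, mul_inv_eq_iff_eq_mul] at hcomm
    exact hcomm.symm
  exact ne_bot_of_le_ne_bot (hk ▸ Nat.find_spec hex) hle

theorem normal_of_le_center {H : Subgroup G} (hH : H ≤ Subgroup.center G) : H.Normal :=
  ⟨fun x hx g => by rwa [Subgroup.mem_center_iff.mp (hH hx) g, mul_inv_cancel_right]⟩

theorem isMulCommutative_sup {H K : Subgroup G} [IsMulCommutative H] [IsMulCommutative K]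
    (h : K ≤ Subgroup.centralizer (H : Set G)) : IsMulCommutative ↥(H ⊔ K) := by
  have h' : H ≤ Subgroup.centralizer (K : Set G) := Subgroup.le_centralizer_iff.mp h
  rw [← Subgroup.le_centralizer_iff_isMulCommutative]
  exact sup_le (Subgroup.le_centralizer_iff.mp (sup_le H.le_centralizer h))
    (Subgroup.le_centralizer_iff.mp (sup_le h' K.le_centralizer))

theorem exists_normal_isMulCommutative_centralizer_le [Finite G] [Group.IsNilpotent G] :
    ∃ A : Subgroup G, A.Normal ∧ IsMulCommutative A ∧ Subgroup.centralizer (A : Set G) ≤ A := by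
  obtain ⟨A, ⟨hA, hAc⟩, hmax⟩ :=
    (Set.toFinite {A : Subgroup G | A.Normal ∧ IsMulCommutative A}).exists_maximal
      ⟨⊥, inferInstance, inferInstance⟩
  refine ⟨A, hA, hAc, ?_⟩
  let π := QuotientGroup.mk' A
  let C := Subgroup.centralizer (A : Set G)
  by_contra hCA
  -- Adjoining to `A` a preimage of a nontrivial central element of `G ⧸ A` that lies in the
  -- image of `C` contradicts maximality.
  have : (C.map π).Normal := Subgroup.Normal.map inferInstance π (QuotientGroup.mk'_surjective A)
  have hne : C.map π ≠ ⊥ := by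
    rwa [Ne, Subgroup.map_eq_bot_iff, QuotientGroup.ker_mk']
  obtain ⟨_, ⟨⟨c, hc, rfl⟩, hcent⟩, hc1⟩ :=
    (Subgroup.bot_or_exists_ne_one _).resolve_left (inf_center_ne_bot hne)
  have hcA : c ∉ A := fun h => hc1 ((QuotientGroup.eq_one_iff c).mpr h)
  have hnormal : (A ⊔ Subgroup.zpowers c).Normal := by
    have hπc : ((Subgroup.zpowers c).map π).Normal := by
      refine normal_of_le_center ?_
      rwa [MonoidHom.map_zpowers, Subgroup.zpowers_le]
    rw [sup_comm, ← QuotientGroup.ker_mk' A, ← Subgroup.comap_map_eq]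
    exact hπc.comap π
  have hcomm : IsMulCommutative ↥(A ⊔ Subgroup.zpowers c) :=
    isMulCommutative_sup (Subgroup.zpowers_le.mpr hc)
  exact hcA (hmax ⟨hnormal, hcomm⟩ le_sup_left
    (Subgroup.mem_sup_right (Subgroup.mem_zpowers c)))

end Nilpotent

section UniqueSubgroup

variable {G : Type*} [Group G] {p : ℕ}

theorem exists_pow_notMem_pow_mem (hG : IsPGroup p G) {A : Subgroup G} {y : G} (hy : y ∉ A) :
    ∃ k : ℕ, y ^ p ^ k ∉ A ∧ (y ^ p ^ k) ^ p ∈ A := by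
  classical
  have hex : ∃ k, y ^ p ^ k ∈ A := (hG y).imp fun k (hk : y ^ p ^ k = 1) => hk ▸ A.one_mem
  obtain ⟨k, hk⟩ : ∃ k, Nat.find hex = k + 1 := Nat.exists_eq_succ_of_ne_zero fun h0 =>
    hy (by simpa [h0] using Nat.find_spec hex)
  refine ⟨k, Nat.find_min hex (hk ▸ k.lt_succ_self), ?_⟩
  rw [← pow_mul, ← pow_succ, ← hk]
  exact Nat.find_spec hex

theorem mem_of_pow_eq_one [Fact p.Prime] (hG : IsPGroup p G)
    (h : {H : Subgroup G | Nat.card H = p}.Subsingleton) {A : Subgroup G} (hA : A ≠ ⊥) {y : G}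
    (hy : y ^ p = 1) : y ∈ A := by
  rcases eq_or_ne y 1 with rfl | hy1
  · exact A.one_mem
  obtain ⟨x, hxA, hx1⟩ := A.bot_or_exists_ne_one.resolve_left hA
  obtain ⟨k, hk1, hkp⟩ := exists_pow_notMem_pow_mem hG (mt Subgroup.mem_bot.mp hx1)
  have card_zpowers_eq {z : G} (hz : z ^ p = 1) (hz1 : z ≠ 1) :
      Nat.card (Subgroup.zpowers z) = p := by
    rw [Nat.card_zpowers, orderOf_eq_prime hz hz1]
  have heq : Subgroup.zpowers y = Subgroup.zpowers (x ^ p ^ k) :=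
    h (card_zpowers_eq hy hy1)
      (card_zpowers_eq (Subgroup.mem_bot.mp hkp) (mt Subgroup.mem_bot.mpr hk1))
  exact Subgroup.zpowers_le.mp (heq.trans_le (Subgroup.zpowers_le.mpr (A.pow_mem hxA _)))

theorem subsingleton_subgroup_of_card_eq (h : {H : Subgroup G | Nat.card H = p}.Subsingleton)
    (A : Subgroup G) : {H : Subgroup A | Nat.card H = p}.Subsingleton := by
  refine (h.preimage (Subgroup.map_injective A.subtype_injective)).anti fun H hH => ?_
  exact (Subgroup.card_map_of_injective A.subtype_injective).trans hH

theorem isCyclic_of_subsingleton_subgroup_of_card_eq {A : Type*} [CommGroup A] [Finite A]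
    [Fact p.Prime] (hA : IsPGroup p A) (h : {H : Subgroup A | Nat.card H = p}.Subsingleton) :
    IsCyclic A := by
  obtain ⟨a, ha⟩ :=
    Monoid.exists_orderOf_eq_exponent (Monoid.ExponentExists.of_finite (G := A))
  refine ⟨a, fun y => by_contra fun hy => ?_⟩
  obtain ⟨k, hk, j, hj : a ^ j = _⟩ := exists_pow_notMem_pow_mem hA (A := Subgroup.zpowers a) hy
  generalize y ^ p ^ k = w at hk hj
  have hw : w ^ orderOf a = 1 := ha ▸ Monoid.pow_exponent_eq_one w
  have ha1 : a ≠ 1 := by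
    rintro rfl
    rw [orderOf_one, pow_one] at hw
    exact hk (hw.symm ▸ Subgroup.one_mem _)
  obtain ⟨n, hn⟩ := hA.exists_orderOf_eq_pow a
  obtain ⟨m, rfl⟩ : ∃ m, n = m + 1 := Nat.exists_eq_succ_of_ne_zero fun h0 =>
    ha1 (orderOf_eq_one_iff.mp (by rw [hn, h0, pow_zero]))
  have hdvd : ((p ^ m * p : ℕ) : ℤ) ∣ (p ^ m : ℕ) * j := by
    rw [← pow_succ, ← hn, orderOf_dvd_iff_zpow_eq_one, mul_comm, zpow_mul, hj, zpow_natCast,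
      ← pow_mul, ← pow_succ', ← hn, hw]
  obtain ⟨i, rfl⟩ : (p : ℤ) ∣ j := by
    rw [Nat.cast_mul] at hdvd
    exact Int.dvd_of_mul_dvd_mul_left
      (Nat.cast_ne_zero.mpr (pow_ne_zero m (Fact.out : p.Prime).ne_zero)) hdvd
  have hpow : (a ^ (-i) * w) ^ p = 1 := by
    rw [mul_pow, ← hj, ← zpow_natCast, ← zpow_mul, ← zpow_add, neg_mul, mul_comm, neg_add_cancel,
      zpow_zero]
  have hmem : a ^ (-i) * w ∈ Subgroup.zpowers a :=
    mem_of_pow_eq_one hA h (Subgroup.zpowers_ne_bot.mpr ha1) hpow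
  exact hk ((Subgroup.mul_mem_cancel_left _ (Subgroup.zpow_mem_zpowers a _)).mp hmem)

end UniqueSubgroup

section Metacyclic

theorem exists_pow_dvd_mul_add {p : ℕ} (hp : p.Prime) (n : ℕ) {N j : ℤ} (hN : (p : ℤ) ∣ N)
    (hN' : ¬ (p : ℤ) ^ 2 ∣ N) (hj : (p : ℤ) ∣ j) : ∃ s : ℤ, (p : ℤ) ^ n ∣ s * N + j := by
  obtain ⟨N, rfl⟩ := hN
  obtain ⟨j, rfl⟩ := hj
  have hpZ : Prime (p : ℤ) := Nat.prime_iff_prime_int.mp hp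
  rw [sq, mul_dvd_mul_iff_left hpZ.ne_zero, ← hpZ.coprime_iff_not_dvd] at hN'
  obtain ⟨u, v, huv⟩ := hN'.pow_left (m := n)
  exact ⟨-(j * v), p * j * u, by linear_combination (-(p : ℤ) * j) * huv⟩

theorem dvd_geom_sum_and_not_sq_dvd {p : ℕ} (hp : p.Prime) {r : ℤ} (hr : (p : ℤ) ∣ r - 1)
    (h2 : p = 2 → ¬ (4 : ℤ) ∣ r + 1) :
    (p : ℤ) ∣ ∑ i ∈ Finset.range p, r ^ i ∧ ¬ (p : ℤ) ^ 2 ∣ ∑ i ∈ Finset.range p, r ^ i := by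
  rcases hp.eq_two_or_odd' with rfl | hodd
  · have h4 := h2 rfl
    simp only [Finset.sum_range_succ, Finset.sum_range_zero, pow_zero, pow_one, Nat.cast_ofNat]
      at hr ⊢
    omega
  · have hpZ : Prime (p : ℤ) := Nat.prime_iff_prime_int.mp hp
    have hpr : ¬ (p : ℤ) ∣ r := fun h => hpZ.not_dvd_one (by simpa using dvd_sub h hr)
    have hmult : emultiplicity (p : ℤ) (∑ i ∈ Finset.range p, r ^ i) = (1 : ℕ) := by
      simpa using emultiplicity_geom_sum₂_eq_one (y := (1 : ℤ)) hpZ hodd hr hpr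
    simpa using emultiplicity_eq_coe.mp hmult

theorem two_pow_dvd_two_mul {n : ℕ} {r k : ℤ} (hr : (4 : ℤ) ∣ r + 1)
    (h : (2 : ℤ) ^ n ∣ k * (r - 1)) : (2 : ℤ) ^ n ∣ 2 * k := by
  obtain ⟨c, hc⟩ := hr
  have hcop : IsCoprime ((2 : ℤ) ^ n) (2 * c - 1) := IsCoprime.pow_left ⟨c, -1, by ring⟩
  refine hcop.dvd_of_dvd_mul_right ?_
  rwa [show 2 * k * (2 * c - 1) = k * (r - 1) by linear_combination -k * hc]

variable {G : Type*} [Group G] {a b : G} {r j : ℤ}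

theorem zpow_mul_pow_of_conj (h : b * a * b⁻¹ = a ^ r) (s : ℤ) (m : ℕ) :
    (a ^ s * b) ^ m = a ^ (s * ∑ i ∈ Finset.range m, r ^ i) * b ^ m := by
  have hc (k : ℤ) : b * a ^ k = a ^ (r * k) * b := by
    rw [zpow_mul, ← h, conj_zpow, inv_mul_cancel_right]
  induction m with
  | zero => simp
  | succ m ih =>
    rw [pow_succ', ih, geom_sum_succ, mul_assoc, ← mul_assoc b, hc, mul_assoc _ b, ← pow_succ',
      ← mul_assoc, ← zpow_add]
    congr 2
    ring

theorem pow_conj_of_conj (h : b * a * b⁻¹ = a ^ r) (m : ℕ) :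
    b ^ m * a * (b ^ m)⁻¹ = a ^ r ^ m := by
  induction m with
  | zero => simp
  | succ m ih =>
    calc b ^ (m + 1) * a * (b ^ (m + 1))⁻¹
        = b * (b ^ m * a * (b ^ m)⁻¹) * b⁻¹ := by rw [pow_succ']; group
      _ = a ^ r ^ (m + 1) := by rw [ih, ← conj_zpow, h, ← zpow_mul, pow_succ']

theorem orderOf_dvd_mul_sub_one (hr : b * a * b⁻¹ = a ^ r) {m : ℕ} (hj : b ^ m = a ^ j) :
    (orderOf a : ℤ) ∣ j * (r - 1) := by
  rw [orderOf_dvd_iff_zpow_eq_one, mul_sub_one, mul_comm, zpow_sub, zpow_mul, ← hr, conj_zpow, ← hj]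
  group

theorem orderOf_dvd_pow_sub_one (hr : b * a * b⁻¹ = a ^ r) {m : ℕ} (hj : b ^ m = a ^ j) :
    (orderOf a : ℤ) ∣ r ^ m - 1 := by
  rw [orderOf_dvd_iff_zpow_eq_one, zpow_sub_one, ← pow_conj_of_conj hr, hj]
  group

theorem exists_zpow_mul_pow_eq_one {p n : ℕ} [Fact p.Prime] (ha : orderOf a = p ^ n)
    (hr : b * a * b⁻¹ = a ^ r) (hj : b ^ p = a ^ j) (hab : ¬ Commute b a)
    (h2 : p = 2 → ¬ (4 : ℤ) ∣ r + 1) : ∃ s : ℤ, (a ^ s * b) ^ p = 1 := by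
  have hp : p.Prime := Fact.out
  have hdvd (k : ℤ) : (p : ℤ) ^ n ∣ k ↔ a ^ k = 1 := by
    rw [← orderOf_dvd_iff_zpow_eq_one, ha, Nat.cast_pow]
  have hr1 : ¬ (p : ℤ) ^ n ∣ r - 1 := by
    rwa [hdvd, zpow_sub_one, ← hr, mul_inv_eq_one, mul_inv_eq_iff_eq_mul]
  have hn : n ≠ 0 := by
    rintro rfl
    exact hr1 (by simp)
  have hpr : (p : ℤ) ∣ r - 1 := by
    have hrp : (p : ℤ) ∣ r ^ p - 1 := by
      refine (dvd_pow_self _ hn).trans ?_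
      exact_mod_cast ha ▸ orderOf_dvd_pow_sub_one hr hj
    rw [← ZMod.intCast_zmod_eq_zero_iff_dvd] at hrp ⊢
    push_cast [ZMod.pow_card] at hrp ⊢
    exact hrp
  have hpj : (p : ℤ) ∣ j := by
    by_contra hpj
    refine hr1 ((Nat.prime_iff_prime_int.mp hp).pow_dvd_of_dvd_mul_left n hpj ?_)
    exact_mod_cast ha ▸ orderOf_dvd_mul_sub_one hr hj
  obtain ⟨hsum, hsum'⟩ := dvd_geom_sum_and_not_sq_dvd hp hpr h2
  obtain ⟨s, hs⟩ := exists_pow_dvd_mul_add hp n hsum hsum' hpj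
  exact ⟨s, by rwa [zpow_mul_pow_of_conj hr, hj, ← zpow_add, ← hdvd]⟩

theorem zpow_eq_pow_of_sq_eq_one {m : ℕ} (ha : orderOf a = 2 * m) {k : ℤ}
    (hk : (a ^ k) ^ 2 = 1) (hk1 : a ^ k ≠ 1) : a ^ k = a ^ m := by
  have hdvd : ((2 * m : ℕ) : ℤ) ∣ 2 * k := by
    rwa [← ha, orderOf_dvd_iff_zpow_eq_one, mul_comm, zpow_mul, zpow_ofNat]
  rw [Nat.cast_mul, Nat.cast_ofNat, mul_dvd_mul_iff_left two_ne_zero] at hdvd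
  obtain ⟨c, rfl⟩ := hdvd
  have ha2 : a ^ (2 * m : ℤ) = 1 := by
    exact_mod_cast ha ▸ pow_orderOf_eq_one a
  obtain ⟨d, rfl | rfl⟩ := Int.even_or_odd' c
  · exact absurd (by rw [← mul_assoc, mul_comm (m : ℤ), zpow_mul, ha2, one_zpow]) hk1
  · rw [show (m : ℤ) * (2 * d + 1) = 2 * m * d + m by ring, zpow_add, zpow_mul, ha2, one_zpow,
      one_mul, zpow_natCast]

theorem conj_eq_inv_and_sq_eq_pow {n : ℕ} (ha : orderOf a = 2 ^ (n + 1))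
    (hr : b * a * b⁻¹ = a ^ r) (hj : b ^ 2 = a ^ j) (h4 : (4 : ℤ) ∣ r + 1)
    (hb : ∀ s : ℤ, (a ^ s * b) ^ 2 ≠ 1) : b * a * b⁻¹ = a⁻¹ ∧ b ^ 2 = a ^ 2 ^ n := by
  have sq_eq_one {k : ℤ} (hk : (orderOf a : ℤ) ∣ k * (r - 1)) : (a ^ k) ^ 2 = 1 := by
    have hk2 : (2 : ℤ) ^ (n + 1) ∣ 2 * k := two_pow_dvd_two_mul h4 (by exact_mod_cast ha ▸ hk)
    rw [← zpow_ofNat, ← zpow_mul, mul_comm, ← orderOf_dvd_iff_zpow_eq_one, ha]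
    exact_mod_cast hk2
  have eq_involution {k : ℤ} : (a ^ k) ^ 2 = 1 → a ^ k ≠ 1 → a ^ k = a ^ 2 ^ n :=
    zpow_eq_pow_of_sq_eq_one (ha.trans (pow_succ' 2 n))
  have hj1 : a ^ j ≠ 1 := by simpa [hj] using hb 0
  have hjn : a ^ j = a ^ 2 ^ n := eq_involution (sq_eq_one (orderOf_dvd_mul_sub_one hr hj)) hj1
  have hr2 : (a ^ (r + 1)) ^ 2 = 1 := sq_eq_one (by
    rw [show (r + 1) * (r - 1) = r ^ 2 - 1 by ring]
    exact orderOf_dvd_pow_sub_one hr hj)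
  have hr1 : a ^ (r + 1) = 1 := by
    by_contra hne
    refine hb 1 ?_
    calc (a ^ (1 : ℤ) * b) ^ 2
        = a ^ (r + 1) * a ^ j := by
          rw [zpow_mul_pow_of_conj hr, hj, geom_sum_two, one_mul]
      _ = 1 := by rw [hjn, ← eq_involution hr2 hne, ← sq, hr2]
  exact ⟨by rw [hr, ← mul_eq_one_iff_eq_inv, ← zpow_add_one, hr1], hj.trans hjn⟩

theorem eq_two_and_conj_eq_inv {p n : ℕ} [Fact p.Prime] [(Subgroup.zpowers a).Normal]
    (ha : orderOf a = p ^ (n + 1)) (htors : ∀ y : G, y ^ p = 1 → y ∈ Subgroup.zpowers a)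
    (hab : ¬ Commute b a) (hbp : b ^ p ∈ Subgroup.zpowers a) :
    p = 2 ∧ n ≠ 0 ∧ b * a * b⁻¹ = a⁻¹ ∧ b ^ 2 = a ^ 2 ^ n := by
  obtain ⟨r, hr : a ^ r = b * a * b⁻¹⟩ :=
    Subgroup.Normal.conj_mem ‹_› a (Subgroup.mem_zpowers a) b
  obtain ⟨j, hj : a ^ j = b ^ p⟩ := hbp
  have hb : b ∉ Subgroup.zpowers a := by
    rintro ⟨k, rfl⟩
    exact hab (Commute.zpow_left rfl k)
  have hs (s : ℤ) : (a ^ s * b) ^ p ≠ 1 := fun h =>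
    hb ((Subgroup.mul_mem_cancel_left _ (Subgroup.zpow_mem_zpowers a s)).mp (htors _ h))
  obtain ⟨rfl, h4⟩ : p = 2 ∧ (4 : ℤ) ∣ r + 1 := by
    by_contra hcon
    obtain ⟨s, h⟩ := exists_zpow_mul_pow_eq_one ha hr.symm hj.symm hab fun h2 h4 => hcon ⟨h2, h4⟩
    exact hs s h
  obtain ⟨hinv, hsq⟩ := conj_eq_inv_and_sq_eq_pow ha hr.symm hj.symm h4 hs
  refine ⟨rfl, ?_, hinv, hsq⟩
  rintro rfl
  have ha2 : a * a = 1 := by rw [← sq, ← orderOf_dvd_iff_pow_eq_one, ha, zero_add, pow_one]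
  exact hab (mul_inv_eq_iff_eq_mul.mp (hinv.trans (inv_eq_of_mul_eq_one_left ha2)))

theorem sq_conj_ne_inv (ha : 4 ∣ orderOf a) (hr : b * a * b⁻¹ = a ^ r) :
    b ^ 2 * a * (b ^ 2)⁻¹ ≠ a⁻¹ := by
  rw [pow_conj_of_conj hr, Ne, ← mul_eq_one_iff_eq_inv, ← zpow_add_one,
    ← orderOf_dvd_iff_zpow_eq_one]
  intro h
  have h4 : (4 : ℤ) ∣ r ^ 2 + 1 := (Int.natCast_dvd_natCast.mpr ha).trans h
  obtain ⟨c, rfl | rfl⟩ := Int.even_or_odd' r <;> ring_nf at h4 <;> omega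

end Metacyclic

section Quaternion

variable {G : Type*} [Group G] {a b : G} {m : ℕ}

/-- The homomorphism `k ↦ a ^ k` from `ℤ/n` to a group in which `a ^ n = 1`. -/
def zmodPowersHom {n : ℕ} (ha : a ^ n = 1) : Multiplicative (ZMod n) →* G :=
  AddMonoidHom.toMultiplicativeLeft
    (ZMod.lift n ⟨zmultiplesHom (Additive G) (.ofMul a), by simp [← ofMul_pow, ha]⟩)

theorem zmodPowersHom_intCast {n : ℕ} (ha : a ^ n = 1) (k : ℤ) :
    zmodPowersHom ha (.ofAdd (k : ZMod n)) = a ^ k := by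
  simp [zmodPowersHom]

theorem zmodPowersHom_mul_of_conj_eq_inv {n : ℕ} (ha : a ^ n = 1) (hb : b * a * b⁻¹ = a⁻¹)
    (i : ZMod n) :
    zmodPowersHom ha (.ofAdd i) * b = b * (zmodPowersHom ha (.ofAdd i))⁻¹ := by
  obtain ⟨k, rfl⟩ := ZMod.intCast_surjective i
  have h : SemiconjBy b a⁻¹ a := by
    have h : SemiconjBy b a a⁻¹ := mul_inv_eq_iff_eq_mul.mp hb
    simpa using h.inv_right
  rw [zmodPowersHom_intCast, ← inv_zpow]
  exact (h.zpow_right k).symm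

/-- The homomorphism from the generalized quaternion group given by its presentation, with `b`
playing the role of `xa 0`. -/
def quaternionLift (ha : a ^ (2 * m) = 1) (hconj : b * a * b⁻¹ = a⁻¹) (hsq : b ^ 2 = a ^ m) :
    QuaternionGroup m →* G :=
  MonoidHom.mk' (fun
    | .a i => zmodPowersHom ha (.ofAdd i)
    | .xa i => b * zmodPowersHom ha (.ofAdd i)) <| by
    have hmove := zmodPowersHom_mul_of_conj_eq_inv ha hconj
    have hm : zmodPowersHom ha (.ofAdd (m : ZMod (2 * m))) = b * b := by
      rw [← sq, hsq, ← zpow_natCast, ← zmodPowersHom_intCast ha, Int.cast_natCast]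
    rintro (i | i) (j | j)
    · simp only [QuaternionGroup.a_mul_a, ofAdd_add, map_mul]
    · simp only [QuaternionGroup.a_mul_xa, sub_eq_neg_add, ofAdd_add, map_mul, ofAdd_neg, map_inv,
        ← mul_assoc, hmove]
    · simp only [QuaternionGroup.xa_mul_a, ofAdd_add, map_mul, mul_assoc]
    · rw [QuaternionGroup.xa_mul_xa, add_sub_assoc, sub_eq_neg_add]
      simp only [ofAdd_add, map_mul, ofAdd_neg, map_inv, hm]
      rw [mul_assoc b (zmodPowersHom ha (.ofAdd i)), ← mul_assoc _ b, hmove]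
      simp only [mul_assoc]

theorem nonempty_mulEquiv_quaternionGroup (ha : orderOf a = 2 * m) (hb : b ∉ Subgroup.zpowers a)
    (hconj : b * a * b⁻¹ = a⁻¹) (hsq : b ^ 2 = a ^ m)
    (hcover : ∀ g ∉ Subgroup.zpowers a, b⁻¹ * g ∈ Subgroup.zpowers a) :
    Nonempty (G ≃* QuaternionGroup m) := by
  have ha' : a ^ (2 * m) = 1 := ha ▸ pow_orderOf_eq_one a
  have map_a (k : ℤ) : quaternionLift ha' hconj hsq (.a k) = a ^ k := zmodPowersHom_intCast ha' k
  have map_xa (k : ℤ) : quaternionLift ha' hconj hsq (.xa k) = b * a ^ k :=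
    congrArg (b * ·) (zmodPowersHom_intCast ha' k)
  refine ⟨(MulEquiv.ofBijective (quaternionLift ha' hconj hsq) ⟨?_, fun g => ?_⟩).symm⟩
  · rw [injective_iff_map_eq_one]
    rintro (i | i) hi <;> obtain ⟨k, rfl⟩ := ZMod.intCast_surjective i
    · rw [map_a, ← orderOf_dvd_iff_zpow_eq_one, ha, ← ZMod.intCast_zmod_eq_zero_iff_dvd] at hi
      rw [hi, QuaternionGroup.a_zero]
    · rw [map_xa] at hi
      exact absurd (eq_inv_of_mul_eq_one_left hi ▸
        Subgroup.inv_mem _ (Subgroup.zpow_mem_zpowers a k)) hb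
  · by_cases hg : g ∈ Subgroup.zpowers a
    · obtain ⟨k, rfl⟩ := hg
      exact ⟨.a k, map_a k⟩
    · obtain ⟨k, hk : a ^ k = b⁻¹ * g⟩ := hcover g hg
      exact ⟨.xa k, by rw [map_xa, hk, mul_inv_cancel_left]⟩

end Quaternion

section Classification

variable {G : Type u} [Group G] {p : ℕ}

open scoped IsMulCommutative in
theorem exists_normal_zpowers_centralizer_le [Finite G] [Fact p.Prime] (hG : IsPGroup p G)
    (h : {H : Subgroup G | Nat.card H = p}.Subsingleton) :
    ∃ a : G, (Subgroup.zpowers a).Normal ∧ ∀ x, Commute x a → x ∈ Subgroup.zpowers a := by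
  have : Group.IsNilpotent G := hG.isNilpotent
  obtain ⟨A, hA, hAcomm, hAcent⟩ := exists_normal_isMulCommutative_centralizer_le (G := G)
  have hcyc : IsCyclic A := isCyclic_of_subsingleton_subgroup_of_card_eq (hG.to_subgroup A)
    (subsingleton_subgroup_of_card_eq h A)
  obtain ⟨a, rfl⟩ := A.isCyclic_iff_exists_zpowers_eq_top.mp hcyc
  refine ⟨a, hA, fun x hx => hAcent ?_⟩
  rwa [Subgroup.zpowers_eq_closure, Subgroup.centralizer_closure,
    Subgroup.mem_centralizer_singleton_iff]

theorem sq_mem_zpowers (hG : IsPGroup 2 G) {a : G} [(Subgroup.zpowers a).Normal] {n : ℕ}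
    (ha : orderOf a = 2 ^ (n + 1)) (htors : ∀ y : G, y ^ 2 = 1 → y ∈ Subgroup.zpowers a)
    (hcent : ∀ x, Commute x a → x ∈ Subgroup.zpowers a) (b : G) :
    b ^ 2 ∈ Subgroup.zpowers a := by
  by_cases hb : b ∈ Subgroup.zpowers a
  · exact Subgroup.pow_mem _ hb 2
  obtain ⟨k, hk, hk2⟩ := exists_pow_notMem_pow_mem hG hb
  rcases k with _ | k
  · simpa using hk2
  obtain ⟨-, hn, hinv, -⟩ := eq_two_and_conj_eq_inv ha htors (mt (hcent _) hk) hk2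
  obtain ⟨r, hr : a ^ r = b ^ 2 ^ k * a * (b ^ 2 ^ k)⁻¹⟩ :=
    Subgroup.Normal.conj_mem ‹_› a (Subgroup.mem_zpowers a) (b ^ 2 ^ k)
  have h4 : 4 ∣ orderOf a := by
    rw [ha]
    exact pow_dvd_pow 2 (by omega : 2 ≤ n + 1)
  refine absurd ?_ (sq_conj_ne_inv h4 hr.symm)
  rwa [← pow_mul, ← pow_succ]

theorem eq_two_and_nonempty_mulEquiv_quaternionGroup [Fact p.Prime] (hG : IsPGroup p G)
    {a : G} [(Subgroup.zpowers a).Normal] {n : ℕ} (ha : orderOf a = p ^ (n + 1))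
    (htors : ∀ y : G, y ^ p = 1 → y ∈ Subgroup.zpowers a)
    (hcent : ∀ x, Commute x a → x ∈ Subgroup.zpowers a) {b : G} (hb : b ∉ Subgroup.zpowers a) :
    p = 2 ∧ n ≠ 0 ∧ Nonempty (G ≃* QuaternionGroup (2 ^ n)) := by
  obtain ⟨k, hk, hkp⟩ := exists_pow_notMem_pow_mem hG hb
  obtain ⟨rfl, hn, -⟩ := eq_two_and_conj_eq_inv ha htors (mt (hcent _) hk) hkp
  have key (g : G) (hg : g ∉ Subgroup.zpowers a) : g * a * g⁻¹ = a⁻¹ ∧ g ^ 2 = a ^ 2 ^ n :=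
    (eq_two_and_conj_eq_inv ha htors (mt (hcent _) hg)
      (sq_mem_zpowers hG ha htors hcent g)).2.2
  refine ⟨rfl, hn, nonempty_mulEquiv_quaternionGroup (ha.trans (pow_succ' 2 n)) hb (key b hb).1
    (key b hb).2 fun g hg => hcent _ ?_⟩
  calc b⁻¹ * g * a
      = b⁻¹ * (g * a * g⁻¹) * g := by group
    _ = b⁻¹ * (b * a * b⁻¹) * g := by rw [(key g hg).1, (key b hb).1]
    _ = a * (b⁻¹ * g) := by group

theorem isNiceGroup_of_subsingleton_subgroup_of_card_eq [Finite G] [Fact p.Prime]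
    (hG : IsPGroup p G) (h : {H : Subgroup G | Nat.card H = p}.Subsingleton) : IsNiceGroup G := by
  obtain ⟨a, hnormal, hcent⟩ := exists_normal_zpowers_centralizer_le hG h
  by_cases htop : ∀ g, g ∈ Subgroup.zpowers a
  · exact Or.inl ⟨p, Fact.out, hG, a, htop⟩
  obtain ⟨b, hb⟩ := not_forall.mp htop
  have ha1 : a ≠ 1 := by
    rintro rfl
    exact hb (hcent b (Commute.one_right b))
  obtain ⟨n, hn⟩ := hG.exists_orderOf_eq_pow a
  obtain ⟨n, rfl⟩ : ∃ m, n = m + 1 := Nat.exists_eq_succ_of_ne_zero fun h0 =>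
    ha1 (orderOf_eq_one_iff.mp (by rw [hn, h0, pow_zero]))
  have htors (y : G) (hy : y ^ p = 1) : y ∈ Subgroup.zpowers a :=
    mem_of_pow_eq_one hG h (Subgroup.zpowers_ne_bot.mpr ha1) hy
  obtain ⟨rfl, hn0, hquat⟩ := eq_two_and_nonempty_mulEquiv_quaternionGroup hG hn htors hcent hb
  exact Or.inr ⟨2 ^ n, Nat.le_self_pow hn0 2, hquat, hG.exists_card_eq⟩

end Classification

section PrimeOrderSubgroups

open Pointwise

variable {G : Type u} [Group G] {p : ℕ} [Fact p.Prime] {H K : Subgroup G}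

theorem ne_bot_of_card_eq_prime (hH : Nat.card H = p) : H ≠ ⊥ := by
  rintro rfl
  exact (Fact.out : p.Prime).ne_one (hH.symm.trans Subgroup.card_bot)

theorem disjoint_of_card_eq_prime (hH : Nat.card H = p) (hK : Nat.card K = p) (hne : H ≠ K) :
    Disjoint H K := by
  have hp : p.Prime := Fact.out
  have : Finite H := Nat.finite_of_card_ne_zero (hH.trans_ne hp.ne_zero)
  have : Finite K := Nat.finite_of_card_ne_zero (hK.trans_ne hp.ne_zero)
  rw [disjoint_iff]
  rcases (Nat.dvd_prime hp).mp (hH ▸ Subgroup.card_dvd_of_le (inf_le_left : H ⊓ K ≤ H)) with h | h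
  · exact Subgroup.eq_bot_of_card_eq _ h
  · have hHK : H ⊓ K = H := Subgroup.eq_of_le_of_card_ge inf_le_left (hH.trans h.symm).le
    have hKH : H ⊓ K = K := Subgroup.eq_of_le_of_card_ge inf_le_right (hK.trans h.symm).le
    exact absurd (hHK.symm.trans hKH) hne

theorem exists_le_center_card_eq [Finite G] [Nontrivial G] (hG : IsPGroup p G) :
    ∃ Z ≤ Subgroup.center G, Nat.card Z = p := by
  have : Nontrivial (Subgroup.center G) := hG.center_nontrivial
  have hdvd : p ∣ Nat.card (Subgroup.center G) :=
    (hG.to_subgroup _).card_eq_or_dvd.resolve_left Finite.one_lt_card.ne'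
  obtain ⟨Z, hZ⟩ := Sylow.exists_subgroup_card_pow_prime p (n := 1) (by rwa [pow_one])
  refine ⟨Z.map (Subgroup.center G).subtype, Subgroup.map_subtype_le Z, ?_⟩
  rw [Subgroup.card_map_of_injective (Subgroup.subtype_injective _), hZ, pow_one]

theorem exists_disjoint_conj_of_isPGroup [Finite G] [Nontrivial G] (hp : IsPGroup p G)
    (hG : ¬ IsNiceGroup G) : ∃ H₁ H₂ : Subgroup G, H₁ ≠ ⊥ ∧ H₂ ≠ ⊥ ∧
      ∀ g : G, Disjoint (MulAut.conj g • H₁) H₂ := by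
  obtain ⟨Z, hZ, hZp⟩ := exists_le_center_card_eq hp
  have hnontrivial : {H : Subgroup G | Nat.card H = p}.Nontrivial :=
    Set.not_subsingleton_iff.mp (mt (isNiceGroup_of_subsingleton_subgroup_of_card_eq hp) hG)
  obtain ⟨H, hH, hne⟩ := hnontrivial.exists_ne Z
  have : Z.Normal := normal_of_le_center hZ
  refine ⟨Z, H, ne_bot_of_card_eq_prime hZp, ne_bot_of_card_eq_prime hH, fun g => ?_⟩
  rw [Subgroup.Normal.conj_smul_eq_self]
  exact disjoint_of_card_eq_prime hZp hH hne.symm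

theorem exists_disjoint_conj_of_not_isPGroup [Finite G] (hpG : p ∣ Nat.card G)
    (hp : ¬ IsPGroup p G) : ∃ H₁ H₂ : Subgroup G, H₁ ≠ ⊥ ∧ H₂ ≠ ⊥ ∧
      ∀ g : G, Disjoint (MulAut.conj g • H₁) H₂ := by
  obtain ⟨q, hq, hqG, hpq⟩ : ∃ q, q.Prime ∧ q ∣ Nat.card G ∧ q ≠ p := by
    by_contra! h
    exact hp (IsPGroup.of_card (Nat.eq_prime_pow_of_unique_prime_dvd Nat.card_pos.ne' (h _)))
  have : Fact q.Prime := ⟨hq⟩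
  obtain ⟨H₁, h₁⟩ := Sylow.exists_subgroup_card_pow_prime p (n := 1) (by rwa [pow_one])
  obtain ⟨H₂, h₂⟩ := Sylow.exists_subgroup_card_pow_prime q (n := 1) (by rwa [pow_one])
  rw [pow_one] at h₁ h₂
  refine ⟨H₁, H₂, ne_bot_of_card_eq_prime h₁, ne_bot_of_card_eq_prime h₂, fun g =>
    Subgroup.disjoint_of_coprime_natCard ?_⟩
  rw [← Nat.card_congr (Subgroup.equivSMul (MulAut.conj g) H₁).toEquiv, h₁, h₂]
  exact (Nat.coprime_primes Fact.out hq).mpr hpq.symm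

theorem exists_disjoint_conj_of_not_isNiceGroup [Finite G] (hG : ¬ IsNiceGroup G) :
    ∃ H₁ H₂ : Subgroup G, H₁ ≠ ⊥ ∧ H₂ ≠ ⊥ ∧ ∀ g : G, Disjoint (MulAut.conj g • H₁) H₂ := by
  have : Nontrivial G := by
    by_contra hG'
    have : Subsingleton G := not_nontrivial_iff_subsingleton.mp hG'
    exact hG (Or.inl ⟨2, Nat.prime_two, IsPGroup.of_subsingleton 2 G, inferInstance⟩)
  obtain ⟨p, hp, hpG⟩ := Nat.exists_prime_and_dvd (Finite.one_lt_card (α := G)).ne'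
  have : Fact p.Prime := ⟨hp⟩
  by_cases hpGroup : IsPGroup p G
  · exact exists_disjoint_conj_of_isPGroup hpGroup hG
  · exact exists_disjoint_conj_of_not_isPGroup hpG hpGroup

end PrimeOrderSubgroups

theorem theorem1 {G : Type u} [Group G] [Finite G] (hG : ¬ IsNiceGroup G) :
    ∃ K₁ K₂ : FiniteGComplex.{u, u} G, K₁.IsFree ∧ K₂.IsFree ∧
      mappingIndex G K₁.Realization = 1 ∧ mappingIndex G K₂.Realization = 1 ∧
      mappingIndex G (K₁.Realization × K₂.Realization) = 0 ∧
      mappingIndex G (K₁.Realization × K₂.Realization) ≠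
        min (mappingIndex G K₁.Realization) (mappingIndex G K₂.Realization) := by
  obtain ⟨H₁, H₂, h₁, h₂, hdisj⟩ := exists_disjoint_conj_of_not_isNiceGroup hG
  refine ⟨cosetGraph H₁, cosetGraph H₂, cosetGraph_isFree H₁, cosetGraph_isFree H₂,
    mappingIndex_cosetGraph h₁, mappingIndex_cosetGraph h₂,
    mappingIndex_cosetGraph_prod_cosetGraph hdisj, ?_⟩
  rw [mappingIndex_cosetGraph h₁, mappingIndex_cosetGraph h₂,
    mappingIndex_cosetGraph_prod_cosetGraph hdisj, min_self]
  exact zero_ne_one
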